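/- Conventions. For a $T_0$ space $X$, a subset $K$ is saturated if it is the intersection of its open neighbourhoods. A space $Y$ is $\omega$-well-filtered if it is $T_0$ and, for every filtered family $(K_i)_{i<\omega}$ of compact saturated subsets of $Y$ (any two members contain a third) and every open $U\subseteq Y$ with $\bigcap_{i<\omega}K_i\subseteq U$, there is $i<\omega$ with $K_i\subseteq U$. A subset $A\subseteq X$ is a $\mathrm{WD}_\omega$-set if for every continuous map $f\colon X\to Y$ to an $\omega$-well-filtered space $Y$ there is a unique $y\in Y$ with $\mathrm{cl}(f(A))=\mathrm{cl}(\{y\})$. A subset of $X$ is $\Pi^0_2$ if its complement has the form $\bigcup_{i\in\mathbb N}U_i\setminus V_i$ with all $U_i,V_i$ open in $X$. $S_1$ denotes $\mathbb N$ with the cofinite topology, and $S_D$ denotes $\mathbb N$ with the Scott topology of its usual order. Theorem. Let $X$ be a first-countable $T_0$ space. (1) If $A\subseteq X$ is a closed $\mathrm{WD}_\omega$-set and $A\neq\mathrm{cl}_X(\{x\})$ for every $x\in X$, then there is a subset $B\subseteq A$ that is $\Pi^0_2$ in $X$, is homeomorphic (with the subspace topology) to $S_D$ or to $S_1$, and satisfies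 $\mathrm{cl}_X(B)=A$. (2) $X$ is $\omega$-well-filtered if and only if $X$ has no $\Pi^0_2$-subset which, with the subspace topology, is homeomorphic to $S_1$ or to $S_D$. -/

import Mathlib

namespace OmegaWF

universe u

/-- Compact saturated subsets: compact (no separation assumed) and equal to the intersection of
all open neighbourhoods (`nhdsKer K`). -/
def IsCompactSaturated {X : Type u} [TopologicalSpace X] (K : Set X) : Prop :=
  IsCompact K ∧ nhdsKer K = K

/-- A space is `ω`-well-filtered if it is `T₀` and, for every countable filtered family
`(K i)_{i < ω}` of compact saturated sets and every open `U`, `⋂ i, K i ⊆ U` implies `K i ⊆ U`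
for some `i`. -/
structure OmegaWellFiltered (X : Type u) [TopologicalSpace X] : Prop where
  t0 : T0Space X
  exists_subset : ∀ K : ℕ → Set X, (∀ i, IsCompactSaturated (K i)) → Directed (· ⊇ ·) K →
    ∀ U : Set X, IsOpen U → ⋂ i, K i ⊆ U → ∃ i, K i ⊆ U

/-- `ω`-well-filtered determined sets (`WD_ω`-sets): for every continuous map `f` into an
`ω`-well-filtered space `Y`, the closure of `f(A)` is the closure of a unique point of `Y`. -/
def IsOmegaWDSet {X : Type u} [TopologicalSpace X] (A : Set X) : Prop :=
  ∀ (Y : Type u) [TopologicalSpace Y], OmegaWellFiltered Y →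
    ∀ f : X → Y, Continuous f → ∃! y : Y, closure (f '' A) = closure {y}

/-- `Σ⁰₂`-sets of a general (non-metrizable) space: countable unions of differences of open
sets. -/
def IsSigma02 {X : Type u} [TopologicalSpace X] (A : Set X) : Prop :=
  ∃ U V : ℕ → Set X, (∀ i, IsOpen (U i)) ∧ (∀ i, IsOpen (V i)) ∧ A = ⋃ i, U i \ V i

/-- `Π⁰₂`-sets: complements of `Σ⁰₂`-sets. -/
def IsPi02 {X : Type u} [TopologicalSpace X] (A : Set X) : Prop :=
  IsSigma02 Aᶜ

/-- The natural numbers with the cofinite topology. -/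
abbrev S1 : Type := CofiniteTopology ℕ

/-- The natural numbers with the Scott topology of the usual order. -/
abbrev SD : Type := Topology.WithScott ℕ

end OmegaWF

namespace OmegaWF

open Set Topology Filter

universe v

section

variable {X : Type u} [TopologicalSpace X]

/-! Everything passes through irreducible closed sets with a countable dense subset. Closed
WD_ω-sets are of this kind, because the space of all such sets with the hit topology is
ω-well-filtered (`omegaWellFiltered`) and receives `X` by `x ↦ closure {x}`. A failure of
ω-well-filteredness also produces one, as a minimal closed set meeting all the `K i`.

Let `A` be such a set and not a point closure. Neighbourhood bases at the points of a countable
dense set give countably many open sets, with one below each open set that meets `A`. By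
irreducibility one can pick points of `A` in their finite intersections `W n`, each outside the
closures of the earlier ones. Ramsey makes this sequence a specialization chain (a copy of `SD`) or
an antichain (a copy of `S1`). Its range is dense in `A` and Π⁰₂.

Conversely, in an ω-well-filtered space the saturated tails of an embedded `S1` or `SD` have a
common point in the closure of the copy. It specializes to the whole copy, and Π⁰₂ would force it
into the copy, which has no dense point. -/

/-- `A` is irreducible and has a countable dense subset. -/
def IsIrreducibleSeparable (A : Set X) : Prop :=
  IsIrreducible A ∧ ∃ D : Set X, D.Countable ∧ D ⊆ A ∧ A ⊆ closure D

/-! ### Minimal closed sets meeting a filtered family of compact sets -/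

/-- If no member of a filtered family of compact sets is contained in the open set `U`, there is
a minimal closed set outside `U` that meets all members. -/
theorem exists_minimal_isClosed_inter_nonempty {K : ℕ → Set X} (hK : ∀ i, IsCompact (K i))
    {U : Set X} (hU : IsOpen U) (h : ∀ i, ¬ K i ⊆ U) :
    ∃ A : Set X, A ⊆ Uᶜ ∧ Minimal (· ∈ {C : Set X | IsClosed C ∧ ∀ i, (K i ∩ C).Nonempty}) A := by
  refine zorn_superset_nonempty _ ?_ Uᶜ ⟨hU.isClosed_compl, fun i => ?_⟩
  · intro c hc hchain hne
    refine ⟨⋂₀ c, ⟨isClosed_sInter fun C hC => (hc hC).1, fun i => ?_⟩,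
      fun s hs => sInter_subset_of_mem hs⟩
    by_contra hemp
    rw [not_nonempty_iff_eq_empty, sInter_eq_iInter] at hemp
    have : Nonempty c := hne.to_subtype
    obtain ⟨C, hC⟩ := (hK i).elim_directed_family_closed (fun C : c => (C : Set X))
      (fun C => (hc C.2).1) hemp (by
        intro C C'
        rcases hchain.total C.2 C'.2 with h1 | h1
        · exact ⟨C, le_rfl, h1⟩
        · exact ⟨C', h1, le_rfl⟩)
    exact ((hc C.2).2 i).ne_empty hC
  · obtain ⟨x, hx, hxU⟩ := not_subset.1 (h i)
    exact ⟨x, hx, hxU⟩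

section Minimal

variable {K : ℕ → Set X} {A : Set X}
  (hA : Minimal (· ∈ {C : Set X | IsClosed C ∧ ∀ i, (K i ∩ C).Nonempty}) A)

include hA

/-- Otherwise `A ∩ Vᶜ` would be a smaller closed set meeting every `K i`. Hence any choice of points
in the `K i ∩ A` is dense in `A`. -/
theorem exists_inter_subset_of_minimal {V : Set X} (hV : IsOpen V) (hAV : (A ∩ V).Nonempty) :
    ∃ i, K i ∩ A ⊆ V := by
  by_contra! hcon
  have hmem : A ∩ Vᶜ ∈ {C : Set X | IsClosed C ∧ ∀ i, (K i ∩ C).Nonempty} := by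
    refine ⟨hA.prop.1.inter hV.isClosed_compl, fun i => ?_⟩
    obtain ⟨x, hx, hxV⟩ := not_subset.1 (hcon i)
    exact ⟨x, hx.1, hx.2, hxV⟩
  obtain ⟨x, hx, hxV⟩ := hAV
  exact (hA.le_of_le hmem inter_subset_left hx).2 hxV

theorem subset_closure_of_minimal {x : ℕ → X} (hx : ∀ i, x i ∈ K i ∩ A) :
    A ⊆ closure (range x) := by
  intro a ha
  refine mem_closure_iff.2 fun V hV haV => ?_
  obtain ⟨i, hi⟩ := exists_inter_subset_of_minimal hA hV ⟨a, ha, haV⟩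
  exact ⟨x i, hi (hx i), mem_range_self i⟩

theorem isIrreducible_of_minimal (hK : Directed (· ⊇ ·) K) : IsIrreducible A := by
  refine ⟨(hA.prop.2 0).mono inter_subset_right, fun V W hV hW hAV hAW => ?_⟩
  obtain ⟨i, hi⟩ := exists_inter_subset_of_minimal hA hV hAV
  obtain ⟨j, hj⟩ := exists_inter_subset_of_minimal hA hW hAW
  obtain ⟨k, hki, hkj⟩ := hK i j
  obtain ⟨x, hxk, hxA⟩ := hA.prop.2 k
  exact ⟨x, hxA, hi ⟨hki hxk, hxA⟩, hj ⟨hkj hxk, hxA⟩⟩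

theorem isIrreducibleSeparable_of_minimal (hK : Directed (· ⊇ ·) K) :
    IsIrreducibleSeparable A := by
  refine ⟨isIrreducible_of_minimal hA hK, ?_⟩
  choose x hx using hA.prop.2
  exact ⟨range x, countable_range x, range_subset_iff.2 fun i => (hx i).2,
    subset_closure_of_minimal hA hx⟩

end Minimal

theorem IsCompactSaturated.mem_of_specializes {K : Set X} (hK : IsCompactSaturated K) {x y : X}
    (hy : y ∈ K) (h : x ⤳ y) : x ∈ K := by
  rw [← hK.2]
  exact mem_nhdsKer_iff_specializes.2 ⟨y, hy, h⟩

/-! ### The space of irreducible separable closed sets -/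

variable (X) in
/-- The closed sets that are irreducible and have a countable dense subset. -/
def IrreducibleSeparableCloseds : Type u :=
  {C : Set X // IsClosed C ∧ IsIrreducibleSeparable C}

namespace IrreducibleSeparableCloseds

/-- The closed sets that meet `U`. -/
def hit (U : Set X) : Set (IrreducibleSeparableCloseds X) := {C | (C.1 ∩ U).Nonempty}

/-- The hit topology (lower Vietoris topology). -/
instance : TopologicalSpace (IrreducibleSeparableCloseds X) where
  IsOpen S := ∃ U : Set X, IsOpen U ∧ S = hit U
  isOpen_univ := ⟨univ, isOpen_univ, by
    ext C
    simpa [hit] using C.2.2.1.1⟩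
  isOpen_inter := by
    rintro _ _ ⟨U, hU, rfl⟩ ⟨V, hV, rfl⟩
    refine ⟨U ∩ V, hU.inter hV, ?_⟩
    ext C
    exact ⟨fun h => C.2.2.1.2 U V hU hV h.1 h.2,
      fun h => ⟨h.mono (by grind), h.mono (by grind)⟩⟩
  isOpen_sUnion := by
    intro s hs
    choose! f hf using hs
    refine ⟨⋃ t ∈ s, f t, isOpen_biUnion fun t ht => (hf t ht).1, ?_⟩
    ext C
    constructor
    · rintro ⟨t, ht, hC⟩
      rw [(hf t ht).2] at hC
      exact hC.mono (inter_subset_inter_right _ (subset_biUnion_of_mem ht))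
    · rintro ⟨x, hxC, hx⟩
      obtain ⟨t, ht, hxt⟩ := mem_iUnion₂.1 hx
      refine ⟨t, ht, ?_⟩
      rw [(hf t ht).2]
      exact ⟨x, hxC, hxt⟩

theorem isOpen_hit {U : Set X} (hU : IsOpen U) : IsOpen (hit U) := ⟨U, hU, rfl⟩

theorem specializes_iff {C C' : IrreducibleSeparableCloseds X} : C ⤳ C' ↔ C'.1 ⊆ C.1 := by
  rw [specializes_iff_forall_open]
  constructor
  · intro h x hx
    by_contra hxC
    obtain ⟨y, hy, hyC⟩ := h _ (isOpen_hit C.2.1.isOpen_compl) ⟨x, hx, hxC⟩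
    exact hyC hy
  · rintro h _ ⟨U, -, rfl⟩ hC'
    exact hC'.mono (inter_subset_inter_left _ h)

/-- The closure of a point. -/
def pointClosure (x : X) : IrreducibleSeparableCloseds X :=
  ⟨closure {x}, isClosed_closure, isIrreducible_singleton.closure, {x}, countable_singleton x,
    subset_closure, subset_rfl⟩

theorem pointClosure_mem_hit {x : X} {U : Set X} (hU : IsOpen U) : pointClosure x ∈ hit U ↔ x ∈ U := by
  constructor
  · rintro ⟨y, hy, hyU⟩
    obtain ⟨z, hz, rfl⟩ := mem_closure_iff.1 hy U hU hyU
    exact hz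
  · exact fun h => ⟨x, subset_closure rfl, h⟩

theorem continuous_pointClosure : Continuous (pointClosure : X → IrreducibleSeparableCloseds X) := by
  refine ⟨?_⟩
  rintro _ ⟨U, hU, rfl⟩
  convert hU using 1
  ext x
  exact pointClosure_mem_hit hU

theorem omegaWellFiltered : OmegaWellFiltered (IrreducibleSeparableCloseds X) where
  t0 := ⟨fun C C' h => Subtype.ext <| Subset.antisymm (specializes_iff.1 h.symm.specializes)
    (specializes_iff.1 h.specializes)⟩
  exists_subset := by
    intro K hK hdir U hU hKU
    by_contra! hcon
    obtain ⟨A, hAU, hA⟩ :=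
      exists_minimal_isClosed_inter_nonempty (fun i => (hK i).1) hU hcon
    obtain ⟨O, hO, hAO⟩ := hA.prop.1.isOpen_compl
    -- Closed sets of the hit topology consist of all members contained in a fixed closed set, here
    -- `Oᶜ`.
    have hmem : ∀ C, C ∈ A ↔ C.1 ⊆ Oᶜ := by
      intro C
      rw [← not_iff_not, ← mem_compl_iff, hAO, subset_compl_iff_disjoint_right,
        not_disjoint_iff_nonempty_inter]
      rfl
    choose x hx using hA.prop.2
    have hdense := subset_closure_of_minimal hA hx
    have hirr := isIrreducible_of_minimal hA hdir
    choose D hDc hDs hDd using fun i => (x i).2.2.2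
    have hsub : ∀ i, (x i).1 ⊆ Oᶜ := fun i => (hmem _).1 (hx i).2
    have hmeets : ∀ V, IsOpen V → (Oᶜ ∩ V).Nonempty → (A ∩ hit V).Nonempty := by
      rintro V hV ⟨y, hyO, hyV⟩
      exact ⟨pointClosure y, (hmem _).2 (closure_minimal (singleton_subset_iff.2 hyO) hO.isClosed_compl),
        (pointClosure_mem_hit hV).2 hyV⟩
    have hOirr : IsIrreducible Oᶜ := by
      refine ⟨(x 0).2.2.1.1.mono (hsub 0), fun V W hV hW hAV hAW => ?_⟩
      obtain ⟨C, hCA, hCV, hCW⟩ := hirr.2 _ _ (isOpen_hit hV) (isOpen_hit hW)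
        (hmeets V hV hAV) (hmeets W hW hAW)
      exact (C.2.2.1.2 V W hV hW hCV hCW).mono (inter_subset_inter_left _ ((hmem C).1 hCA))
    -- `Oᶜ` is itself a point of the space, the generic point of `A`: the countable dense sets of
    -- the countably many `x i` have union dense in `Oᶜ`. It specializes to every `x i`, so
    -- saturation puts it in every `K i`.
    let B : IrreducibleSeparableCloseds X := ⟨Oᶜ, hO.isClosed_compl, hOirr, ⋃ i, D i,
      countable_iUnion hDc, iUnion_subset fun i => (hDs i).trans (hsub i), by
        intro y hy
        refine mem_closure_iff.2 fun V hV hyV => ?_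
        obtain ⟨C, hCA, hCV⟩ := hmeets V hV ⟨y, hy, hyV⟩
        obtain ⟨_, hiV, i, rfl⟩ := mem_closure_iff.1 (hdense hCA) _ (isOpen_hit hV) hCV
        obtain ⟨z, hzC, hzV⟩ := hiV
        obtain ⟨w, hwV, hwD⟩ := mem_closure_iff.1 (hDd i hzC) V hV hzV
        exact ⟨w, hwV, mem_iUnion.2 ⟨i, hwD⟩⟩⟩
    have hBA : B ∈ A := (hmem B).2 subset_rfl
    refine hAU hBA (hKU (mem_iInter.2 fun i => ?_))
    exact (hK i).mem_of_specializes (hx i).1 (specializes_iff.2 (hsub i))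

end IrreducibleSeparableCloseds

open IrreducibleSeparableCloseds in
-- The point `C` supplied by the WD_ω property for `pointClosure` meets the same open sets as `A`,
-- and two closed sets with this property are equal.
theorem IsOmegaWDSet.isIrreducibleSeparable {A : Set X} (hA : IsOmegaWDSet A)
    (hcl : IsClosed A) : IsIrreducibleSeparable A := by
  obtain ⟨C, hC, -⟩ := hA _ omegaWellFiltered pointClosure continuous_pointClosure
  suffices h : A = C.1 by
    rw [h]
    exact C.2.2
  have key : ∀ U, IsOpen U → ((A ∩ U).Nonempty ↔ (C.1 ∩ U).Nonempty) := by
    intro U hU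
    have h1 : (A ∩ U).Nonempty ↔ (closure (pointClosure '' A) ∩ hit U).Nonempty := by
      rw [closure_inter_open_nonempty_iff (isOpen_hit hU)]
      constructor
      · rintro ⟨x, hxA, hxU⟩
        exact ⟨pointClosure x, mem_image_of_mem _ hxA, (pointClosure_mem_hit hU).2 hxU⟩
      · rintro ⟨_, ⟨x, hxA, rfl⟩, hxU⟩
        exact ⟨x, hxA, (pointClosure_mem_hit hU).1 hxU⟩
    rw [h1, hC, closure_inter_open_nonempty_iff (isOpen_hit hU), singleton_inter_nonempty]
    rfl
  refine Subset.antisymm (fun x hx => ?_) (fun x hx => ?_)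
  · by_contra hxC
    obtain ⟨y, hy, hy'⟩ := (key _ C.2.1.isOpen_compl).1 ⟨x, hx, hxC⟩
    exact hy' hy
  · by_contra hxA
    obtain ⟨y, hy, hy'⟩ := (key _ hcl.isOpen_compl).2 ⟨x, hx, hxA⟩
    exact hy' hy

/-! ### The spaces `S1` and `SD` -/

theorem SD.isOpen_iff {s : Set SD} : IsOpen s ↔ IsUpperSet s := by
  rw [IsScott.isOpen_iff_isUpperSet_and_dirSupInaccOn (D := univ)]
  refine ⟨fun h => h.1, fun h => ⟨h, ?_⟩⟩
  intro d _ hd hdir a ha has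
  by_contra hcon
  have hlt : ∀ b ∈ d, Topology.WithScott.ofScott b < Topology.WithScott.ofScott a := by
    intro b hb
    by_contra hab
    exact hcon ⟨b, hb, h (Nat.not_lt.1 hab : a ≤ b) has⟩
  obtain ⟨b, hb⟩ := hd
  -- The element `b` lies strictly below `a`, so the truncated `a - 1` is a strictly smaller upper
  -- bound.
  have hub : Topology.WithScott.toScott (Topology.WithScott.ofScott a - 1) ∈ upperBounds d :=
    fun c hc => (Nat.le_sub_one_of_lt (hlt c hc) : _)
  have h1 : Topology.WithScott.ofScott a ≤ Topology.WithScott.ofScott a - 1 := ha.2 hub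
  have h2 := hlt b hb
  omega

/-- An infinite space in which all proper closed sets are finite and no point is dense does not
embed as a `Π⁰₂`-subset into an `ω`-well-filtered space. -/
theorem OmegaWellFiltered.not_isPi02_range {Z : Type v} [TopologicalSpace Z] [Infinite Z]
    (hfin : ∀ C : Set Z, IsClosed C → C.Infinite → C = univ)
    (hgen : ∀ z : Z, closure {z} ≠ univ) (hX : OmegaWellFiltered X) {e : Z → X}
    (he : IsEmbedding e) : ¬ IsPi02 (range e) := by
  rintro ⟨U, V, hU, hV, hUV⟩
  -- One nonempty member of a cover already misses only finitely many points.
  have hcomp : ∀ s : Set Z, IsCompact s := by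
    intro s
    refine isCompact_of_finite_subcover fun {ι} W hW hs => ?_
    classical
    rcases s.eq_empty_or_nonempty with rfl | ⟨z, hz⟩
    · exact ⟨∅, by simp⟩
    obtain ⟨i, hi⟩ := mem_iUnion.1 (hs hz)
    have hWi : (W i)ᶜ.Finite := by
      by_contra hinf
      have := hfin _ (hW i).isClosed_compl hinf
      exact (this ▸ mem_univ z : z ∈ (W i)ᶜ) hi
    obtain ⟨t, ht⟩ := (hWi.inter_of_right s).isCompact.elim_finite_subcover W hW
      (inter_subset_left.trans hs)
    refine ⟨insert i t, fun y hy => ?_⟩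
    by_cases hyi : y ∈ W i
    · exact mem_biUnion (Finset.mem_insert_self i t) hyi
    · exact biUnion_mono (fun j hj => Finset.mem_insert_of_mem hj) (fun _ _ => subset_rfl)
        (ht ⟨hy, hyi⟩)
  let z : ℕ ↪ Z := Infinite.natEmbedding Z
  let K : ℕ → Set X := fun n => nhdsKer (e '' (z '' Ici n))
  have hanti : Antitone K := fun m n h =>
    nhdsKer_mono (image_mono (image_mono (Ici_subset_Ici.2 h)))
  have hK : ∀ n, IsCompactSaturated (K n) := fun n =>
    ⟨((hcomp _).image he.continuous).nhdsKer, nhdsKer_nhdsKer _⟩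
  have hnot : ¬ ⋂ n, K n ⊆ (closure (range e))ᶜ := by
    intro hsub
    obtain ⟨n, hn⟩ := hX.exists_subset K hK (hanti.directed_ge) _
      isClosed_closure.isOpen_compl hsub
    exact hn (subset_nhdsKer (mem_image_of_mem e (mem_image_of_mem z (mem_Ici.2 le_rfl))))
      (subset_closure (mem_range_self _))
  obtain ⟨x, hxK, hx⟩ := not_subset.1 hnot
  rw [mem_compl_iff, not_not] at hx
  -- Each tail contains a point to which `x` specializes, so this closed set is infinite.
  have hpre : e ⁻¹' closure {x} = univ := by
    refine hfin _ (isClosed_closure.preimage he.continuous) fun hf => ?_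
    have hf' : (z ⁻¹' (e ⁻¹' closure {x})).Finite := hf.preimage z.injective.injOn
    obtain ⟨N, hN⟩ := hf'.bddAbove
    obtain ⟨_, ⟨_, ⟨m, hm, rfl⟩, rfl⟩, hxm⟩ :=
      mem_nhdsKer_iff_specializes.1 (mem_iInter.1 hxK (N + 1))
    have := hN (specializes_iff_mem_closure.1 hxm : m ∈ z ⁻¹' (e ⁻¹' closure {x}))
    have hm' : N + 1 ≤ m := hm
    omega
  have hspec : ∀ y, x ⤳ e y := fun y =>
    specializes_iff_mem_closure.2 (hpre ▸ mem_univ y : y ∈ e ⁻¹' closure {x})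
  by_cases hxr : x ∈ range e
  · obtain ⟨y, rfl⟩ := hxr
    refine hgen y (eq_univ_of_forall fun w => ?_)
    exact specializes_iff_mem_closure.1 (he.specializes_iff.1 (hspec w))
  -- `U i` contains some `e y`, and `V i` does not, since it would then contain `x`.
  · have : x ∈ ⋃ i, U i \ V i := hUV ▸ hxr
    obtain ⟨i, hxU, hxV⟩ := mem_iUnion.1 this
    obtain ⟨_, hyU, y, rfl⟩ := mem_closure_iff.1 hx (U i) (hU i) hxU
    have hy : e y ∈ (range e)ᶜ := by
      rw [hUV]
      exact mem_iUnion.2 ⟨i, hyU, fun h => hxV ((hspec y).mem_open (hV i) h)⟩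
    exact hy (mem_range_self y)

theorem OmegaWellFiltered.not_isPi02_range_of_S1 (hX : OmegaWellFiltered X) {e : S1 → X}
    (he : IsEmbedding e) : ¬ IsPi02 (range e) := by
  have : Infinite S1 := CofiniteTopology.of.infinite_iff.1 inferInstance
  refine hX.not_isPi02_range (fun C hC hinf => ?_) (fun z hz => ?_) he
  · exact (CofiniteTopology.isClosed_iff.1 hC).resolve_right hinf
  · have h : IsClosed ({z} : Set S1) := CofiniteTopology.isClosed_iff.2 (Or.inr (finite_singleton z))
    rw [h.closure_eq] at hz
    exact infinite_univ (hz ▸ finite_singleton z)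

theorem OmegaWellFiltered.not_isPi02_range_of_SD (hX : OmegaWellFiltered X) {e : SD → X}
    (he : IsEmbedding e) : ¬ IsPi02 (range e) := by
  have : Infinite SD := inferInstanceAs (Infinite ℕ)
  have hIic : ∀ z : SD, (Iic z).Finite := fun z => finite_Iic (Topology.WithScott.ofScott z)
  refine hX.not_isPi02_range (fun C hC hinf => ?_) (fun z hz => ?_) he
  · refine eq_univ_of_forall fun z => ?_
    obtain ⟨y, hyC, hy⟩ := hinf.exists_notMem_finite (hIic z)
    have hlow : IsUpperSet Cᶜ := SD.isOpen_iff.1 hC.isOpen_compl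
    by_contra hzC
    exact hlow (le_of_not_ge (α := ℕ) hy : z ≤ y) hzC hyC
  · rw [IsScott.closure_singleton] at hz
    exact infinite_univ (hz ▸ hIic z)

/-! ### Dense copies of `S1` and `SD` in irreducible separable closed sets -/

/-- A generic sequence with no point below an earlier one: the properties from which dense copies
of `S1` and `SD` are built. -/
theorem IsIrreducibleSeparable.exists_seq [FirstCountableTopology X] {A : Set X}
    (hA : IsIrreducibleSeparable A) (hcl : IsClosed A) (hgen : ∀ x, A ≠ closure {x}) :
    ∃ (W : ℕ → Set X) (x : ℕ → X), (∀ n, IsOpen (W n)) ∧ Antitone W ∧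
      (∀ U, IsOpen U → (A ∩ U).Nonempty → ∃ n, W n ⊆ U) ∧ (∀ n, x n ∈ A ∩ W n) ∧
      (∀ m n, m < n → x n ∉ closure {x m}) ∧
      ((∀ m n, m < n → x m ∈ closure {x n}) ∨ (∀ m n, m < n → x m ∉ closure {x n})) := by
  obtain ⟨hirr, D, hDc, hDA, hAD⟩ := hA
  have hDne : D.Nonempty := closure_nonempty_iff.1 (hirr.1.mono hAD)
  obtain ⟨d, rfl⟩ := hDc.exists_eq_range hDne
  choose b hb hbasis using fun m => (nhds_basis_opens (d m)).exists_antitone_subbasis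
  have hfinite := isIrreducible_iff_sInter.1 hirr
  classical
  let N : ℕ → Set X := fun k => b k.unpair.1 k.unpair.2
  have hNo : ∀ k, IsOpen (N k) := fun k => (hb _ _).2
  have hNA : ∀ k, (A ∩ N k).Nonempty := fun k => ⟨d k.unpair.1, hDA (mem_range_self _), (hb _ _).1⟩
  let W : ℕ → Set X := fun n => ⋂ k ∈ Finset.range (n + 1), N k
  have hWo : ∀ n, IsOpen (W n) := fun n => isOpen_biInter_finset fun k _ => hNo k
  have hWanti : Antitone W := fun m n h =>
    biInter_subset_biInter_left fun k hk => by simp at hk ⊢; omega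
  have hWN : ∀ n, W n ⊆ N n := fun n => biInter_subset_of_mem (by simp)
  have hWA : ∀ U, IsOpen U → (A ∩ U).Nonempty → ∃ n, W n ⊆ U := by
    rintro U hU ⟨a, haA, haU⟩
    obtain ⟨_, hdU, m, rfl⟩ := mem_closure_iff.1 (hAD haA) U hU haU
    obtain ⟨k, hk⟩ := (hbasis m).mem_iff.1 (hU.mem_nhds hdU)
    refine ⟨Nat.pair m k, (hWN _).trans ?_⟩
    simpa [N] using hk
  have hstep : ∀ s : Finset (ℕ × X), (∀ p ∈ s, p.2 ∈ A ∩ W p.1) →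
      ∃ q : ℕ × X, q.2 ∈ A ∩ W q.1 ∧ ∀ p ∈ s, p.1 < q.1 ∧ q.2 ∉ closure {p.2} := by
    intro s hs
    -- The new index exceeds all earlier ones. The new point must lie in finitely many open sets
    -- that each meet `A`; the complement of `closure {p.2}` does because `A` is not a point
    -- closure.
    set n := s.sup Prod.fst + 1 with hn
    obtain ⟨y, hyA, hy⟩ := hfinite
      ((Finset.range (n + 1)).image N ∪ s.image fun p => (closure {p.2})ᶜ)
      (by
        intro u hu
        rcases Finset.mem_union.1 hu with hu | hu <;> obtain ⟨p, -, rfl⟩ := Finset.mem_image.1 hu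
        · exact hNo p
        · exact isClosed_closure.isOpen_compl)
      (by
        intro u hu
        rcases Finset.mem_union.1 hu with hu | hu <;> obtain ⟨p, hp, rfl⟩ := Finset.mem_image.1 hu
        · exact hNA p
        · by_contra hemp
          refine hgen p.2 (Subset.antisymm (fun a ha => ?_)
            (closure_minimal (singleton_subset_iff.2 (hs p hp).1) hcl))
          by_contra hap
          exact hemp ⟨a, ha, hap⟩)
    refine ⟨(n, y), ⟨hyA, mem_iInter₂.2 fun k hk => ?_⟩, fun p hp => ⟨?_, ?_⟩⟩
    · exact hy _ (by simpa using Or.inl ⟨k, by simpa using hk, rfl⟩)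
    · exact Nat.lt_succ_of_le (Finset.le_sup (f := Prod.fst) hp)
    · exact hy _ (Finset.mem_coe.2 (Finset.mem_union_right _
        (Finset.mem_image_of_mem (fun p : ℕ × X => (closure {p.2})ᶜ) hp)))
  obtain ⟨f, hfP, hfr⟩ := exists_seq_of_forall_finset_exists
    (fun p : ℕ × X => p.2 ∈ A ∩ W p.1) (fun p q => p.1 < q.1 ∧ q.2 ∉ closure {p.2}) hstep
  let r : X → X → Prop := fun x y => x ∈ closure {y}
  have : IsTrans X r := ⟨fun x y z hxy hyz =>
    closure_minimal (singleton_subset_iff.2 hyz) isClosed_closure hxy⟩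
  -- Ramsey's theorem for the transitive relation `r`.
  obtain ⟨g, hg⟩ := exists_increasing_or_nonincreasing_subseq r fun n => (f n).2
  have hmono : StrictMono fun n => (f (g n)).1 := fun m n h => (hfr _ _ (g.strictMono h)).1
  refine ⟨W, fun n => (f (g n)).2, hWo, hWanti, hWA, fun n => ⟨(hfP _).1, ?_⟩,
    fun m n h => (hfr _ _ (g.strictMono h)).2, hg⟩
  exact hWanti (hmono.le_apply) (hfP (g n)).2

/-! ### Generic sequences: density, Π⁰₂ range, embeddings -/

section Sequence

variable {A : Set X} {W : ℕ → Set X} {x : ℕ → X}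

theorem mem_closure_range_of_generic (hWA : ∀ U, IsOpen U → (A ∩ U).Nonempty → ∃ n, W n ⊆ U)
    (hx : ∀ n, x n ∈ A ∩ W n) (hcl : IsClosed A) : closure (range x) = A := by
  refine Subset.antisymm (closure_minimal (range_subset_iff.2 fun n => (hx n).1) hcl) ?_
  intro a ha
  refine mem_closure_iff.2 fun U hU haU => ?_
  obtain ⟨n, hn⟩ := hWA U hU ⟨a, ha, haU⟩
  exact ⟨x n, hn (hx n).2, mem_range_self n⟩

/-- The range consists of the `y ∈ A` such that `y ∉ F n` implies `y ∈ O n k` for all `n`, `k`. If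
such a `y` first enters `F` through `closure {x i}`, the sets `N m k` with `m > i` exclude it, so it
lies in every `b i k` and equals `x i` by T₀. If it never enters, it lies in every `W n`, so `A =
closure {y}`. -/
theorem isPi02_range_of_generic [T0Space X] [FirstCountableTopology X] (hcl : IsClosed A)
    (hgen : ∀ x, A ≠ closure {x}) (hWo : ∀ n, IsOpen (W n)) (hW : Antitone W)
    (hWA : ∀ U, IsOpen U → (A ∩ U).Nonempty → ∃ n, W n ⊆ U)
    (hx : ∀ n, x n ∈ A ∩ W n) (hlt : ∀ m n, m < n → x n ∉ closure {x m}) :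
    IsPi02 (range x) := by
  choose b hb hbasis using fun m => (nhds_basis_opens (x m)).exists_antitone_subbasis
  let F : ℕ → Set X := fun n => ⋃ i ∈ Finset.range n, closure {x i}
  have hF : ∀ n, IsClosed (F n) := fun n => isClosed_biUnion_finset fun _ _ => isClosed_closure
  have hFmono : Monotone F := fun m n h =>
    biUnion_subset_biUnion_left fun k hk => by simp at hk ⊢; omega
  have hFmem : ∀ {n y}, y ∈ F n ↔ ∃ i < n, y ∈ closure {x i} := by simp [F]
  let N : ℕ → ℕ → Set X := fun m k => b m k ∩ W m ∩ (F m)ᶜ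
  have hN : ∀ m k, IsOpen (N m k) := fun m k =>
    ((hb m k).2.inter (hWo m)).inter (hF m).isOpen_compl
  have hxN : ∀ m k, x m ∈ N m k := fun m k =>
    ⟨⟨(hb m k).1, (hx m).2⟩, fun h => by
      obtain ⟨i, hi, h⟩ := hFmem.1 h
      exact hlt i m hi h⟩
  let O : ℕ → ℕ → Set X := fun n k => ⋃ m ≥ n, N m k
  have hO : ∀ n k, IsOpen (O n k) := fun n k => isOpen_biUnion fun m _ => hN m k
  -- Index 0 encodes `y ∈ A`; index `i + 1` encodes the condition for the pair `i.unpair`.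
  let U : ℕ → Set X := fun j => j.casesOn Aᶜ fun i => (F i.unpair.1)ᶜ
  let V : ℕ → Set X := fun j => j.casesOn ∅ fun i => O i.unpair.1 i.unpair.2
  refine ⟨U, V, ?_, ?_, ?_⟩
  · rintro (_ | i)
    · exact hcl.isOpen_compl
    · exact (hF _).isOpen_compl
  · rintro (_ | i)
    · exact isOpen_empty
    · exact hO _ _
  refine Subset.antisymm (fun y hy => ?_) (iUnion_subset ?_)
  · by_contra hcon
    have hnot : ∀ j, y ∈ U j → y ∈ V j := by
      intro j hj
      by_contra hV
      exact hcon (mem_iUnion.2 ⟨j, hj, hV⟩)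
    have hyA : y ∈ A := by
      by_contra h
      exact hnot 0 h
    have hFO : ∀ n k, y ∉ F n → y ∈ O n k := by
      intro n k h
      have := hnot (Nat.pair n k + 1)
      simp only [U, V, Nat.unpair_pair] at this
      exact this h
    by_cases hex : ∃ n, y ∈ F n
    · obtain ⟨n, hn, hmin⟩ : ∃ n, y ∈ F n ∧ ∀ m < n, y ∉ F m := by
        classical
        exact ⟨Nat.find hex, Nat.find_spec hex, fun m hm => Nat.find_min hex hm⟩
      obtain ⟨i, hi, hyi⟩ := hFmem.1 hn
      obtain rfl : n = i + 1 := by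
        by_contra hne
        exact hmin (i + 1) (by omega) (hFmem.2 ⟨i, by omega, hyi⟩)
      have hyb : ∀ k, y ∈ b i k := by
        intro k
        obtain ⟨m, hm, hym⟩ := mem_iUnion₂.1 (hFO i k (hmin i (by omega)))
        obtain rfl | hm' := eq_or_lt_of_le hm
        · exact hym.1.1
        · exact absurd (hFmono hm' hn) hym.2
      have hspec : y ⤳ x i := by
        refine specializes_iff_forall_open.2 fun s hs hxs => ?_
        obtain ⟨k, hk⟩ := (hbasis i).mem_iff.1 (hs.mem_nhds hxs)
        exact hk (hyb k)
      exact hy ⟨i, ((specializes_iff_mem_closure.2 hyi).antisymm hspec).eq⟩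
    · push Not at hex
      refine hgen y (Subset.antisymm (fun a ha => ?_)
        (closure_minimal (singleton_subset_iff.2 hyA) hcl))
      refine mem_closure_iff.2 fun S hS haS => ?_
      obtain ⟨n, hn⟩ := hWA S hS ⟨a, ha, haS⟩
      obtain ⟨m, hm, hym⟩ := mem_iUnion₂.1 (hFO n 0 (hex n))
      exact ⟨y, hn (hW hm hym.1.2), rfl⟩
  · rintro (_ | i) y ⟨hyU, hyV⟩ ⟨j, rfl⟩
    · exact hyU (hx j).1
    · refine hyV (mem_iUnion₂.2 ⟨j, ?_, hxN j _⟩)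
      by_contra hlt'
      exact hyU (hFmem.2 ⟨j, by omega, subset_closure rfl⟩)

theorem injective_of_notMem_closure (hlt : ∀ m n, m < n → x n ∉ closure {x m}) :
    Function.Injective x := by
  refine Function.Injective.of_lt_imp_ne fun m n h hmn => hlt m n h ?_
  rw [hmn]
  exact subset_closure rfl

/-- An open set meeting `A` contains a tail of the sequence. -/
theorem exists_tail_subset (hW : Antitone W)
    (hWA : ∀ U, IsOpen U → (A ∩ U).Nonempty → ∃ n, W n ⊆ U)
    (hx : ∀ n, x n ∈ A ∩ W n) {U : Set X} (hU : IsOpen U) {i : ℕ} (hi : x i ∈ U) :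
    ∃ n, ∀ m ≥ n, x m ∈ U := by
  obtain ⟨n, hn⟩ := hWA U hU ⟨x i, (hx i).1, hi⟩
  exact ⟨n, fun m hm => hn (hW hm (hx m).2)⟩

/-- In an antichain `closure {x i}` contains no other term, so finite sets are relatively closed;
nonempty open traces contain a tail, so they are cofinite. -/
theorem isEmbedding_S1_of_generic (hW : Antitone W)
    (hWA : ∀ U, IsOpen U → (A ∩ U).Nonempty → ∃ n, W n ⊆ U) (hx : ∀ n, x n ∈ A ∩ W n)
    (hlt : ∀ m n, m < n → x n ∉ closure {x m}) (hgt : ∀ m n, m < n → x m ∉ closure {x n}) :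
    IsEmbedding (x ∘ CofiniteTopology.of.symm) := by
  refine ⟨⟨?_⟩, (injective_of_notMem_closure hlt).comp CofiniteTopology.of.symm.injective⟩
  refine TopologicalSpace.ext_iff.2 fun s => ?_
  rw [isOpen_induced_iff, CofiniteTopology.isOpen_iff']
  constructor
  · rintro (rfl | hs)
    · exact ⟨∅, isOpen_empty, rfl⟩
    · refine ⟨(⋃ i ∈ sᶜ, closure {x (CofiniteTopology.of.symm i)})ᶜ,
        (hs.isClosed_biUnion fun _ _ => isClosed_closure).isOpen_compl, ?_⟩
      ext j
      simp only [preimage_compl, mem_compl_iff, mem_preimage, mem_iUnion, Function.comp_apply,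
        not_exists]
      constructor
      · intro h
        by_contra hj
        exact h j hj (subset_closure rfl)
      · intro hj i hi hmem
        rcases lt_trichotomy (CofiniteTopology.of.symm i) (CofiniteTopology.of.symm j) with h | h | h
        · exact hlt _ _ h hmem
        · exact hi (CofiniteTopology.of.symm.injective h ▸ hj)
        · exact hgt _ _ h hmem
  · rintro ⟨U, hU, rfl⟩
    rcases eq_empty_or_nonempty ((x ∘ CofiniteTopology.of.symm) ⁻¹' U) with h | ⟨i, hi⟩
    · exact Or.inl h
    · right
      obtain ⟨n, hn⟩ := exists_tail_subset hW hWA hx hU hi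
      refine ((finite_Iio n).preimage CofiniteTopology.of.symm.injective.injOn).subset
        fun j hj => ?_
      by_contra hjn
      exact hj (hn _ (not_lt.1 hjn))

/-- Specialization makes open traces upper sets. A nonempty upper set omits finitely many indices,
and removing the closures of those terms cuts it out. -/
theorem isEmbedding_SD_of_chain
    (hlt : ∀ m n, m < n → x n ∉ closure {x m}) (hgt : ∀ m n, m < n → x m ∈ closure {x n}) :
    IsEmbedding (x ∘ Topology.WithScott.ofScott) := by
  refine ⟨⟨?_⟩, (injective_of_notMem_closure hlt).comp Topology.WithScott.ofScott.injective⟩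
  refine TopologicalSpace.ext_iff.2 fun s => ?_
  rw [isOpen_induced_iff, SD.isOpen_iff]
  constructor
  · intro hs
    rcases s.eq_empty_or_nonempty with rfl | ⟨k, hk⟩
    · exact ⟨∅, isOpen_empty, rfl⟩
    have hfin : sᶜ.Finite := (finite_Iio (Topology.WithScott.ofScott k)).subset fun j hj => by
      by_contra hjk
      exact hj (hs (Nat.not_lt.1 hjk : k ≤ j) hk)
    refine ⟨(⋃ i ∈ sᶜ, closure {x (Topology.WithScott.ofScott i)})ᶜ,
      (hfin.isClosed_biUnion fun _ _ => isClosed_closure).isOpen_compl, ?_⟩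
    ext j
    simp only [preimage_compl, mem_compl_iff, mem_preimage, mem_iUnion, Function.comp_apply,
      not_exists]
    constructor
    · intro h
      by_contra hj
      exact h j hj (subset_closure rfl)
    · intro hj i hi hmem
      by_contra
      refine hlt _ _ (Nat.not_le.1 fun hji => hi (hs (hji : j ≤ i) hj)) hmem
  · rintro ⟨U, hU, rfl⟩ i j hij hi
    rcases (show Topology.WithScott.ofScott i ≤ Topology.WithScott.ofScott j from hij).eq_or_lt
      with h | h
    · simpa [← h] using hi
    · exact (specializes_iff_mem_closure.2 (hgt _ _ h)).mem_open hU hi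

end Sequence

/-! ### Assembling both statements -/

theorem IsIrreducibleSeparable.exists_isPi02 [T0Space X] [FirstCountableTopology X] {A : Set X}
    (hA : IsIrreducibleSeparable A) (hcl : IsClosed A) (hgen : ∀ x, A ≠ closure {x}) :
    ∃ B : Set X, B ⊆ A ∧ IsPi02 B ∧ (Nonempty (B ≃ₜ SD) ∨ Nonempty (B ≃ₜ S1)) ∧
      closure B = A := by
  obtain ⟨W, x, hWo, hW, hWA, hx, hlt, hgt⟩ := hA.exists_seq hcl hgen
  refine ⟨range x, range_subset_iff.2 fun n => (hx n).1,
    isPi02_range_of_generic hcl hgen hWo hW hWA hx hlt, ?_,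
    mem_closure_range_of_generic hWA hx hcl⟩
  rcases hgt with hgt | hgt
  · left
    have he := isEmbedding_SD_of_chain hlt hgt
    have hr := Topology.WithScott.ofScott.surjective.range_comp x
    exact ⟨(he.toHomeomorph.trans (Homeomorph.setCongr hr)).symm⟩
  · right
    have he := isEmbedding_S1_of_generic hW hWA hx hlt hgt
    have hr := CofiniteTopology.of.symm.surjective.range_comp x
    exact ⟨(he.toHomeomorph.trans (Homeomorph.setCongr hr)).symm⟩

theorem exists_isPi02_of_not_omegaWellFiltered [T0Space X] [FirstCountableTopology X]
    (hX : ¬ OmegaWellFiltered X) :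
    ∃ B : Set X, IsPi02 B ∧ (Nonempty (B ≃ₜ S1) ∨ Nonempty (B ≃ₜ SD)) := by
  by_contra hcon
  refine hX ⟨inferInstance, fun K hK hdir U hU hKU => ?_⟩
  by_contra! hnot
  obtain ⟨A, hAU, hA⟩ := exists_minimal_isClosed_inter_nonempty (fun i => (hK i).1) hU hnot
  obtain ⟨B, -, hB, hS, -⟩ :=
    -- If `A` were `closure {x}`, saturation would put `x` in every `K i`, hence in `U`, which `A`
    -- misses.
    (isIrreducibleSeparable_of_minimal hA hdir).exists_isPi02 hA.prop.1 (by
      rintro x rfl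
      refine hAU (subset_closure rfl : x ∈ closure {x}) (hKU (mem_iInter.2 fun i => ?_))
      obtain ⟨y, hyK, hy⟩ := hA.prop.2 i
      exact (hK i).mem_of_specializes hyK (specializes_iff_mem_closure.2 hy))
  exact hcon ⟨B, hB, hS.symm⟩

theorem OmegaWellFiltered.not_exists_isPi02 (hX : OmegaWellFiltered X) :
    ¬ ∃ B : Set X, IsPi02 B ∧ (Nonempty (B ≃ₜ S1) ∨ Nonempty (B ≃ₜ SD)) := by
  rintro ⟨B, hB, ⟨⟨e⟩⟩ | ⟨⟨e⟩⟩⟩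
  · refine hX.not_isPi02_range_of_S1 (IsEmbedding.subtypeVal.comp e.symm.isEmbedding) ?_
    rwa [e.symm.surjective.range_comp, Subtype.range_coe]
  · refine hX.not_isPi02_range_of_SD (IsEmbedding.subtypeVal.comp e.symm.isEmbedding) ?_
    rwa [e.symm.surjective.range_comp, Subtype.range_coe]

end

end OmegaWF

theorem mainTheorem2 (X : Type*) [TopologicalSpace X] [T0Space X]
    [FirstCountableTopology X] :
    (∀ A : Set X, IsClosed A → OmegaWF.IsOmegaWDSet A → (∀ x : X, A ≠ closure {x}) →
      ∃ B : Set X, B ⊆ A ∧ OmegaWF.IsPi02 B ∧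
        (Nonempty (B ≃ₜ OmegaWF.SD) ∨ Nonempty (B ≃ₜ OmegaWF.S1)) ∧ closure B = A) ∧
    (OmegaWF.OmegaWellFiltered X ↔
      ¬ ∃ B : Set X, OmegaWF.IsPi02 B ∧
        (Nonempty (B ≃ₜ OmegaWF.S1) ∨ Nonempty (B ≃ₜ OmegaWF.SD))) := by
  refine ⟨fun A hA hWD hgen => (hWD.isIrreducibleSeparable hA).exists_isPi02 hA hgen,
    fun hX => hX.not_exists_isPi02, fun h => ?_⟩
  by_contra hX
  exact h (OmegaWF.exists_isPi02_of_not_omegaWellFiltered hX)
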